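/- Let $G=(V,E)$ be a finite undirected simple graph with $n=|V|$ vertices and $m=|E|\ge 1$ edges in which every vertex has positive degree. Let $A$ be its adjacency matrix, $D$ its diagonal degree matrix and $P=D^{-1}A$. Fix $\alpha\in(0,1)$, an integer $T\ge 1$, and put $$\Pi=\sum_{r=0}^{\infty}\alpha(1-\alpha)^rP^r,\qquad \Pi'=\sum_{r=0}^{T}\alpha(1-\alpha)^rP^r,\qquad \alpha_{sum}=\sum_{i=1}^{T}\alpha(1-\alpha)^i .$$ (The series converges.) For an integer $N\ge1$ let $\tilde\Pi$ be the random matrix produced as follows. Start with the edgeless weighted graph $\tilde G$ on $V$ and repeat $N$ times, independently: pick a uniformly random edge, with a uniformly random orientation $(u,v)$; pick $r\in\{1,\dots,T\}$ with probability $\alpha(1-\alpha)^r/\alpha_{sum}$; pick $j\in\{1,\dots,r\}$ uniformly; run a $(j-1)$-step simple random walk from $u$, ending at $n_0$, and an independent $(r-j)$-step simple random walk from $v$, ending at $n_r$; let $n_0,n_1,\dots,n_r$ be the resulting path through the edge $(u,v)=(n_{j-1},n_j)$, let $Z_p=\sum_{i=1}^{r}2/A_{n_{i-1}n_i}$, and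 add weight $2rm/(NZ_p)$ to the edge $\{n_0,n_r\}$ of $\tilde G$. Finally let $\tilde L$ be the Laplacian matrix of $\tilde G$ and $\tilde\Pi=\alpha I+\alpha_{sum}(I-D^{-1}\tilde L)$. There is an absolute constant $C>0$ such that, for all such $G$, $\alpha$, $T$, every $0<\epsilon\le 1/2$ and every number of samples $N\ge C\,T\,m\log n/\epsilon^2$, the truncation error satisfies $\|\Pi-\Pi'\|_F\le\sqrt n\,(1-\alpha)^{T+1}$ and, with probability at least $1-1/n$, both $\|\Pi'-\tilde\Pi\|_F\le 4\epsilon\,\alpha_{sum}\sqrt n$ and $$\|\Pi-\tilde\Pi\|_F\le\sqrt n\,\bigl((1-\alpha)^{T+1}+4\epsilon\cdot\alpha_{sum}\bigr).$$ -/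

import Mathlib

namespace PPRSparsifier

noncomputable section

section Matrices

variable {V : Type*} [Fintype V] [DecidableEq V]

/-- The random-walk transition matrix `P = D⁻¹ A` of a graph. -/
def transitionMatrix (G : SimpleGraph V) [DecidableRel G.Adj] : Matrix V V ℝ :=
  (G.degMatrix ℝ)⁻¹ * G.adjMatrix ℝ

/-- The exact personalized PageRank matrix `Π = ∑_{r ≥ 0} α (1 - α)^r P^r`. -/
def pprMatrix (G : SimpleGraph V) [DecidableRel G.Adj] (α : ℝ) : Matrix V V ℝ :=
  ∑' r : ℕ, (α * (1 - α) ^ r) • transitionMatrix G ^ r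

/-- The `T`-truncated PPR matrix `Π' = ∑_{r = 0}^{T} α (1 - α)^r P^r`. -/
def truncatedPPR (G : SimpleGraph V) [DecidableRel G.Adj] (α : ℝ) (T : ℕ) : Matrix V V ℝ :=
  ∑ r ∈ Finset.range (T + 1), (α * (1 - α) ^ r) • transitionMatrix G ^ r

/-- `α_sum = ∑_{i = 1}^{T} α (1 - α)^i`. -/
def alphaSum (α : ℝ) (T : ℕ) : ℝ := ∑ i ∈ Finset.Icc 1 T, α * (1 - α) ^ i

/-- The Laplacian matrix `D - W` of the weighted undirected graph with (symmetric) weight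
matrix `W`; a loop contributes nothing to it. -/
def weightedLaplacian (W : Matrix V V ℝ) : Matrix V V ℝ :=
  Matrix.diagonal (fun x => ∑ y, W x y) - W

/-- Add weight `w` to the undirected edge `{a, b}` of the weighted graph `W`. -/
def addEdge (W : Matrix V V ℝ) (a b : V) (w : ℝ) : Matrix V V ℝ :=
  Matrix.of fun x y => if s(x, y) = s(a, b) then W x y + w else W x y

end Matrices

lemma alphaSum_pos {α : ℝ} {T : ℕ} (hα : α ∈ Set.Ioo (0 : ℝ) 1) (hT : 1 ≤ T) :
    0 < alphaSum α T := by
  have h1 : 0 < 1 - α := by linarith [hα.2]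
  exact Finset.sum_pos (fun i _ => mul_pos hα.1 (pow_pos h1 i)) ⟨1, by simp [hT]⟩

lemma pathLength_sum {α : ℝ} {T : ℕ} (hα : α ∈ Set.Ioo (0 : ℝ) 1) (hT : 1 ≤ T) :
    ∑ i : Fin T, ENNReal.ofReal (α * (1 - α) ^ (i.val + 1) / alphaSum α T) = 1 := by
  have h1 : 0 < 1 - α := by linarith [hα.2]
  have h0 := alphaSum_pos hα hT
  rw [← ENNReal.ofReal_sum_of_nonneg, ← Finset.sum_div]
  · have h : ∑ i : Fin T, α * (1 - α) ^ (i.val + 1) = alphaSum α T := by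
      rw [Fin.sum_univ_eq_sum_range (fun i => α * (1 - α) ^ (i + 1)) T, alphaSum,
        Finset.range_eq_Ico, Finset.sum_Ico_add' (fun i => α * (1 - α) ^ i) 0 T 1]
      rfl
    rw [h, div_self h0.ne', ENNReal.ofReal_one]
  · intro i _
    exact div_nonneg (mul_nonneg hα.1.le (pow_nonneg h1.le _)) h0.le

section Sampling

variable {V : Type*} [Fintype V] [DecidableEq V]

/-- The law of the random path length: `i : Fin T` stands for the length `r = i + 1 ∈ [1, T]`,
which has probability `α (1 - α)^r / α_sum`. -/
def pathLength {α : ℝ} {T : ℕ} (hα : α ∈ Set.Ioo (0 : ℝ) 1) (hT : 1 ≤ T) : PMF (Fin T) :=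
  PMF.ofFintype (fun i => ENNReal.ofReal (α * (1 - α) ^ (i.val + 1) / alphaSum α T))
    (pathLength_sum hα hT)

/-- One step of the simple random walk: a uniformly random neighbour of `v`.
(The walk stays put at an isolated vertex.) -/
def step (G : SimpleGraph V) [DecidableRel G.Adj] (v : V) : PMF V :=
  if h : (G.neighborFinset v).Nonempty then PMF.uniformOfFinset (G.neighborFinset v) h
  else PMF.pure v

/-- A `k`-step random walk `v = x₀, x₁, …, x_k`. It returns the endpoint `x_k` together with the
sum `∑ 2 / A(x_i, x_{i+1})` along the edges walked. -/
def walk (G : SimpleGraph V) [DecidableRel G.Adj] : ℕ → V → PMF (V × ℝ)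
  | 0, v => PMF.pure (v, 0)
  | k + 1, v => (step G v).bind fun w =>
      (walk G k w).bind fun q => PMF.pure (q.1, 2 / G.adjMatrix ℝ v w + q.2)

/-- Path sampling from the edge `(u, v)` with length `r`: pick `j` uniformly in `[1, r]`
(`k : Fin r` stands for `j - 1`), walk `j - 1` steps from `u` to `n₀` and `r - j` steps from `v` to
`n_r`, and return `n₀`, `n_r` and `Z_p = ∑ 2 / A(n_{i-1}, n_i)`, the sum being over all `r` edges
of the path. -/
def pathSampling (G : SimpleGraph V) [DecidableRel G.Adj] (u v : V) (r : ℕ) [NeZero r] :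
    PMF (V × V × ℝ) :=
  (PMF.uniformOfFintype (Fin r)).bind fun k =>
    (walk G k.val u).bind fun p =>
      (walk G (r - 1 - k.val) v).bind fun q =>
        PMF.pure (p.1, q.1, p.2 + 2 / G.adjMatrix ℝ u v + q.2)

/-- One pass through the loop of the algorithm: a uniformly random edge `e = (u, v)` (in a
uniformly random orientation), a random length `r`, a sampled path with endpoints `u', v'`; weight
`2 r m / (N Z_p)` is added to the edge `{u', v'}` of the current weighted graph `W`. -/
def addSample (G : SimpleGraph V) [DecidableRel G.Adj] [Nonempty G.Dart] {α : ℝ} {T : ℕ}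
    (hα : α ∈ Set.Ioo (0 : ℝ) 1) (hT : 1 ≤ T) (N : ℕ) (W : Matrix V V ℝ) :
    PMF (Matrix V V ℝ) :=
  (PMF.uniformOfFintype G.Dart).bind fun e =>
    (pathLength hα hT).bind fun i =>
      (pathSampling G e.fst e.snd (i.val + 1)).bind fun s =>
        PMF.pure (addEdge W s.1 s.2.1
          (2 * ((i.val + 1 : ℕ) : ℝ) * (G.edgeFinset.card : ℝ) / ((N : ℝ) * s.2.2)))

/-- The random weighted graph after `k` passes through the loop, starting from the graph without
edges; `N` is the total number of passes, on which the weights depend. -/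
def sampledGraph (G : SimpleGraph V) [DecidableRel G.Adj] [Nonempty G.Dart] {α : ℝ} {T : ℕ}
    (hα : α ∈ Set.Ioo (0 : ℝ) 1) (hT : 1 ≤ T) (N : ℕ) : ℕ → PMF (Matrix V V ℝ)
  | 0 => PMF.pure 0
  | k + 1 => (sampledGraph G hα hT N k).bind fun W => addSample G hα hT N W

/-- The output law of the path-sampling algorithm with `N` samples:
`Π̃ = α I + α_sum (I - D⁻¹ L̃)`, where `L̃` is the Laplacian of the sampled graph. -/
def sparsePPR (G : SimpleGraph V) [DecidableRel G.Adj] [Nonempty G.Dart] {α : ℝ} {T : ℕ}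
    (hα : α ∈ Set.Ioo (0 : ℝ) 1) (hT : 1 ≤ T) (N : ℕ) : PMF (Matrix V V ℝ) :=
  (sampledGraph G hα hT N N).map fun W =>
    α • (1 : Matrix V V ℝ) +
      alphaSum α T • ((1 : Matrix V V ℝ) - (G.degMatrix ℝ)⁻¹ * weightedLaplacian W)

end Sampling

end

end PPRSparsifier

open scoped Matrix.Norms.Frobenius

/-!
The theorem asks only for the Frobenius norm, and that norm comes from an inner product on matrices.
So a Bernstein inequality for vectors of a Hilbert space, free of the dimension, suffices, and no
matrix Chernoff bound is needed.

*Reduction to a sum of independent vectors.* Every edge has `A = 1`, so `Z_p = 2 r` holds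
deterministically and each sample adds weight `m / N` (`addSample_eq_map`). By reversibility a
uniformly random edge extended by random walks in both directions is a stationary walk, so that
the endpoints of a sample have the law `q(a, b) = d_a R(a, b) / (2 m)`, where
`R = ∑ᵣ (α (1 - α)^r / α_sum) P^r` (`toReal_endpointLaw_apply`). Hence `N D⁻¹ L̃` is a sum of `N`
independent copies of `X = m D⁻¹ (e_a - e_b) (e_a - e_b)ᵀ`, and `𝔼 X = I - R`
(`sum_smul_sampleMatrix`). As `Π' = α I + α_sum R` (`truncatedPPR_eq`), this gives
`Π' - Π̃ = α_sum (D⁻¹ L̃ - 𝔼 X)`.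

*Moments.* `‖X‖ ≤ 2 m` and, since both endpoints are distributed as `d / (2 m)`,
`𝔼 ‖X‖² ≤ 2 m² 𝔼 (1 / d_a + 1 / d_b) = 2 m n` (`sum_norm_sampleMatrix_sq_le`).

*Concentration.* By convexity of `s ↦ cosh √s`, a centred step `Y` with `‖Y‖ ≤ 1` satisfies
`𝔼 cosh ‖x + Y‖ ≤ cosh ‖x‖ exp (𝔼 ‖Y‖²)` for every `x` (`sum_cosh_norm_add_le`). Induction over
the passes of the algorithm and Markov's inequality bound the probability of
`‖D⁻¹ L̃ - 𝔼 X‖ ≥ 4 ε √n` by `2 exp (- (3 / 2) N ε² / m)`, which is at most `2 / n³ ≤ 1 / n` as soon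
as `N ≥ 2 m log n / ε²`.

*Truncation.* `P^r` is row-stochastic, so `‖P^r‖ ≤ √n`, and the tail of the series is bounded by
a geometric series.
-/

namespace PPRSparsifier

/-! ### A Bernstein inequality in inner product spaces -/

/-- `s ↦ cosh √s` is convex on `[0, ∞)`, its power series having nonnegative coefficients. The
statement is the chord inequality between `s = (a - b)²` and `s = (a + b)²`, where the hyperbolic
addition formulas evaluate the end points. -/
lemma cosh_le_of_sq_eq {a b c θ : ℝ} (hθ : |θ| ≤ 1) (hc : c ^ 2 = a ^ 2 + 2 * θ * (a * b) + b ^ 2) :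
    Real.cosh c ≤ Real.cosh a * Real.cosh b + θ * (Real.sinh a * Real.sinh b) := by
  obtain ⟨hθ1, hθ2⟩ := abs_le.1 hθ
  have h1 := ((Real.hasSum_cosh (a + b)).mul_left ((1 + θ) / 2)).add
    ((Real.hasSum_cosh (a - b)).mul_left ((1 - θ) / 2))
  have h2 := hasSum_le (fun n => ?_) (Real.hasSum_cosh c) h1
  · rw [Real.cosh_add, Real.cosh_sub] at h2
    linarith
  · have hconvex : ConvexOn ℝ (Set.Ici 0) fun s : ℝ => s ^ n := convexOn_pow n
    have hconv := hconvex.2 (sq_nonneg (a + b)) (sq_nonneg (a - b))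
      (show 0 ≤ (1 + θ) / 2 by linarith) (show 0 ≤ (1 - θ) / 2 by linarith) (by ring)
    have hc' : (1 + θ) / 2 * (a + b) ^ 2 + (1 - θ) / 2 * (a - b) ^ 2 = c ^ 2 := by
      rw [hc]; ring
    simp only [smul_eq_mul, hc', ← pow_mul] at hconv
    rw [← mul_div_assoc, ← mul_div_assoc, ← add_div]
    gcongr

section Hilbert

variable {H : Type*} [NormedAddCommGroup H] [InnerProductSpace ℝ H]

/-- The one-step bound behind the concentration inequality: the right-hand side is affine in the
direction of `y`, so that the inner product disappears when `y` is averaged over a centred law. -/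
lemma cosh_norm_add_le (x y : H) :
    Real.cosh ‖x + y‖ ≤ Real.cosh ‖x‖ * (Real.exp ‖y‖ - ‖y‖) +
      Real.sinh ‖x‖ / ‖x‖ * inner ℝ x y := by
  set a := ‖x‖ with ha
  set b := ‖y‖ with hb
  set θ := inner ℝ x y / (a * b) with hθd
  -- If `x` or `y` vanishes, then `θ = 0` by the convention on division by zero.
  have hinner : inner ℝ x y = θ * (a * b) := by
    by_cases h : a * b = 0
    · rcases mul_eq_zero.1 h with h' | h'
      · simp [h', norm_eq_zero.1 h']
      · simp [h', norm_eq_zero.1 h']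
    · rw [hθd, div_mul_cancel₀ _ h]
  have hθ : |θ| ≤ 1 := abs_real_inner_div_norm_mul_norm_le_one x y
  have h1 := cosh_le_of_sq_eq (a := a) (b := b) (c := ‖x + y‖) hθ
    (by rw [norm_add_sq_real, hinner]; ring)
  have hsa : 0 ≤ Real.sinh a := Real.sinh_nonneg_iff.2 (norm_nonneg x)
  have hsb : b ≤ Real.sinh b := Real.self_le_sinh_iff.2 (norm_nonneg y)
  have hac : Real.sinh a ≤ Real.cosh a := (Real.sinh_lt_cosh a).le
  have h2 : Real.sinh a / a * inner ℝ x y = θ * (Real.sinh a * b) := by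
    rw [hinner]
    by_cases h : a = 0
    · simp [h]
    · field_simp
  rw [h2, ← Real.cosh_add_sinh b]
  -- Only the part `sinh b - b` of `sinh b` beyond the linear one is estimated by `θ ≤ 1`.
  have h3 : θ * (Real.sinh a * (Real.sinh b - b)) ≤ Real.sinh a * (Real.sinh b - b) :=
    mul_le_of_le_one_left (mul_nonneg hsa (sub_nonneg.2 hsb)) (abs_le.1 hθ).2
  have h4 : Real.sinh a * (Real.sinh b - b) ≤ Real.cosh a * (Real.sinh b - b) :=
    mul_le_mul_of_nonneg_right hac (sub_nonneg.2 hsb)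
  linarith

/-- Averaging `cosh_norm_add_le` over a centred step of norm at most `1`. -/
lemma sum_cosh_norm_add_le {ι : Type*} [Fintype ι] {w : ι → ℝ} (hw : ∀ i, 0 ≤ w i)
    (hw1 : ∑ i, w i = 1) {Y : ι → H} (hY0 : ∑ i, w i • Y i = 0) (hY1 : ∀ i, ‖Y i‖ ≤ 1)
    (x : H) :
    ∑ i, w i * Real.cosh ‖x + Y i‖ ≤ Real.cosh ‖x‖ * Real.exp (∑ i, w i * ‖Y i‖ ^ 2) := by
  have hstep (i : ι) : w i * Real.cosh ‖x + Y i‖ ≤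
      Real.cosh ‖x‖ * (w i + w i * ‖Y i‖ ^ 2) +
        Real.sinh ‖x‖ / ‖x‖ * inner ℝ x (w i • Y i) := by
    have h1 := cosh_norm_add_le x (Y i)
    have h2 := Real.abs_exp_sub_one_sub_id_le (x := ‖Y i‖) (by simpa using hY1 i)
    have h3 := mul_le_mul_of_nonneg_left
      (show Real.exp ‖Y i‖ - ‖Y i‖ ≤ 1 + ‖Y i‖ ^ 2 by linarith [(abs_le.1 h2).2])
      (Real.cosh_pos ‖x‖).le
    have h4 := mul_le_mul_of_nonneg_left (h1.trans (add_le_add_left h3 _)) (hw i)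
    rw [real_inner_smul_right]
    linarith
  calc ∑ i, w i * Real.cosh ‖x + Y i‖
      ≤ ∑ i, (Real.cosh ‖x‖ * (w i + w i * ‖Y i‖ ^ 2) +
        Real.sinh ‖x‖ / ‖x‖ * inner ℝ x (w i • Y i)) := Finset.sum_le_sum fun i _ => hstep i
    _ = Real.cosh ‖x‖ * (∑ i, w i * ‖Y i‖ ^ 2 + 1) := by
      rw [Finset.sum_add_distrib, ← Finset.mul_sum, ← Finset.mul_sum, ← inner_sum, hY0,
        inner_zero_right, Finset.sum_add_distrib, hw1]
      ring
    _ ≤ _ := mul_le_mul_of_nonneg_left (Real.add_one_le_exp _) (Real.cosh_pos _).le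

/-- Centring does not increase the second moment. -/
lemma sum_norm_sub_mean_sq_le {ι : Type*} [Fintype ι] {w : ι → ℝ}
    (hw1 : ∑ i, w i = 1) (X : ι → H) :
    ∑ i, w i * ‖X i - ∑ j, w j • X j‖ ^ 2 ≤ ∑ i, w i * ‖X i‖ ^ 2 := by
  set M := ∑ j, w j • X j with hM
  have h : ∑ i, w i * ‖X i - M‖ ^ 2 = ∑ i, w i * ‖X i‖ ^ 2 - ‖M‖ ^ 2 := by
    have h1 (i : ι) : w i * ‖X i - M‖ ^ 2 =
        w i * ‖X i‖ ^ 2 - 2 * inner ℝ (w i • X i) M + w i * ‖M‖ ^ 2 := by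
      rw [norm_sub_sq_real, real_inner_smul_left]; ring
    simp_rw [h1]
    rw [Finset.sum_add_distrib, Finset.sum_sub_distrib, ← Finset.mul_sum, ← sum_inner, ← hM,
      ← Finset.sum_mul, hw1, real_inner_self_eq_norm_sq]
    ring
  rw [h]
  linarith [sq_nonneg ‖M‖]

lemma norm_mean_le {ι : Type*} [Fintype ι] {w : ι → ℝ} (hw : ∀ i, 0 ≤ w i)
    (hw1 : ∑ i, w i = 1) {X : ι → H} {B : ℝ} (hX : ∀ i, ‖X i‖ ≤ B) :
    ‖∑ i, w i • X i‖ ≤ B :=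
  calc ‖∑ i, w i • X i‖ ≤ ∑ i, w i * B := norm_sum_le_of_le _ fun i _ => by
        rw [norm_smul, Real.norm_of_nonneg (hw i)]
        exact mul_le_mul_of_nonneg_left (hX i) (hw i)
    _ = B := by rw [← Finset.sum_mul, hw1, one_mul]

end Hilbert

/-! ### Expectations with respect to a `PMF` -/

lemma sum_toReal_eq_one {ι : Type*} [Fintype ι] (p : PMF ι) : ∑ i, (p i).toReal = 1 := by
  rw [← ENNReal.toReal_sum fun i _ => p.apply_ne_top i, ← tsum_fintype (L := .unconditional ι),
    p.tsum_coe, ENNReal.toReal_one]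

lemma tsum_pure_mul {β : Type*} (b : β) (g : β → ENNReal) :
    ∑' x, PMF.pure b x * g x = g b := by
  rw [tsum_eq_single b fun x hx => by rw [PMF.pure_apply_of_ne _ _ hx, zero_mul],
    PMF.pure_apply_self, one_mul]

lemma tsum_bind_mul {α β : Type*} (p : PMF α) (f : α → PMF β) (g : β → ENNReal) :
    ∑' b, p.bind f b * g b = ∑' a, p a * ∑' b, f a b * g b := by
  simp_rw [PMF.bind_apply, ← ENNReal.tsum_mul_right, ← ENNReal.tsum_mul_left]
  rw [ENNReal.tsum_comm]
  simp_rw [mul_assoc]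

lemma tsum_map_mul {α β : Type*} (p : PMF α) (f : α → β) (g : β → ENNReal) :
    ∑' b, p.map f b * g b = ∑' a, p a * g (f a) := by
  rw [← PMF.bind_pure_comp, tsum_bind_mul]
  simp_rw [Function.comp_apply, tsum_pure_mul]

lemma tsum_mul_ofReal {ι : Type*} [Fintype ι] (p : PMF ι) {g : ι → ℝ} (hg : ∀ i, 0 ≤ g i) :
    ∑' i, p i * ENNReal.ofReal (g i) = ENNReal.ofReal (∑ i, (p i).toReal * g i) := by
  rw [tsum_fintype, ENNReal.ofReal_sum_of_nonneg fun i _ =>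
    mul_nonneg ENNReal.toReal_nonneg (hg i)]
  refine Finset.sum_congr rfl fun i _ => ?_
  rw [ENNReal.ofReal_mul ENNReal.toReal_nonneg, ENNReal.ofReal_toReal (p.apply_ne_top i)]

lemma toOuterMeasure_add_compl {β : Type*} (p : PMF β) (s : Set β) :
    p.toOuterMeasure s + p.toOuterMeasure sᶜ = 1 := by
  rw [PMF.toOuterMeasure_apply, PMF.toOuterMeasure_apply, ← ENNReal.tsum_add, ← p.tsum_coe]
  congr 1
  funext x
  by_cases hx : x ∈ s <;> simp [hx]

/-- Markov's inequality. -/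
lemma mul_toOuterMeasure_le {β : Type*} (p : PMF β) {g : β → ENNReal} {c : ENNReal} {s : Set β}
    (hs : ∀ b ∈ s, c ≤ g b) : c * p.toOuterMeasure s ≤ ∑' b, p b * g b := by
  rw [PMF.toOuterMeasure_apply, ← ENNReal.tsum_mul_left]
  refine ENNReal.tsum_le_tsum fun b => ?_
  by_cases hb : b ∈ s
  · rw [Set.indicator_of_mem hb, mul_comm]
    gcongr
    exact hs b hb
  · simp [hb]

section Chain

variable {H : Type*} [NormedAddCommGroup H] [InnerProductSpace ℝ H]
  {ι β : Type*} [Fintype ι] {p : PMF ι} {Y : ι → H} {f : β → ι → β} {ρ : ℕ → PMF β}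
  {F : ℕ → β → H}

/-- A chain `ρ` whose moves `f · i` are driven by independent samples `i` of `p`, observed through
`F`, which every move shifts by the centred vector `Y i`. -/
lemma tsum_chain_mul_cosh_le (hY0 : ∑ i, (p i).toReal • Y i = 0) (hY1 : ∀ i, ‖Y i‖ ≤ 1)
    {b₀ : β} (hρ0 : ρ 0 = PMF.pure b₀) (hρ : ∀ k, ρ (k + 1) = (ρ k).bind fun b => p.map (f b))
    (hF0 : F 0 b₀ = 0) (hF : ∀ k b i, F (k + 1) (f b i) = F k b + Y i) (k : ℕ) :
    ∑' b, ρ k b * ENNReal.ofReal (Real.cosh ‖F k b‖) ≤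
      ENNReal.ofReal (Real.exp (k * ∑ i, (p i).toReal * ‖Y i‖ ^ 2)) := by
  set v := ∑ i, (p i).toReal * ‖Y i‖ ^ 2 with hv
  induction k with
  | zero => simp [hρ0, hF0]
  | succ k ih =>
    rw [hρ, tsum_bind_mul]
    have h1 (b : β) : ∑' x, p.map (f b) x * ENNReal.ofReal (Real.cosh ‖F (k + 1) x‖) ≤
        ENNReal.ofReal (Real.cosh ‖F k b‖) * ENNReal.ofReal (Real.exp v) := by
      rw [tsum_map_mul, tsum_mul_ofReal p fun i => (Real.cosh_pos _).le,
        ← ENNReal.ofReal_mul (Real.cosh_pos _).le]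
      simp_rw [hF]
      exact ENNReal.ofReal_le_ofReal (sum_cosh_norm_add_le (fun i => ENNReal.toReal_nonneg)
        (sum_toReal_eq_one p) hY0 hY1 _)
    calc _ ≤ ∑' b, ρ k b * (ENNReal.ofReal (Real.cosh ‖F k b‖) * ENNReal.ofReal (Real.exp v)) :=
          ENNReal.tsum_le_tsum fun b => by gcongr; exact h1 b
      _ = (∑' b, ρ k b * ENNReal.ofReal (Real.cosh ‖F k b‖)) * ENNReal.ofReal (Real.exp v) := by
          simp_rw [← mul_assoc, ENNReal.tsum_mul_right]
      _ ≤ ENNReal.ofReal (Real.exp (k * v)) * ENNReal.ofReal (Real.exp v) := by gcongr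
      _ = _ := by
          rw [← ENNReal.ofReal_mul (Real.exp_pos _).le, ← Real.exp_add]
          push_cast
          ring_nf

/-- The resulting tail bound, for steps of norm at most `1`. -/
lemma toOuterMeasure_chain_le (hY0 : ∑ i, (p i).toReal • Y i = 0) (hY1 : ∀ i, ‖Y i‖ ≤ 1)
    {b₀ : β} (hρ0 : ρ 0 = PMF.pure b₀) (hρ : ∀ k, ρ (k + 1) = (ρ k).bind fun b => p.map (f b))
    (hF0 : F 0 b₀ = 0) (hF : ∀ k b i, F (k + 1) (f b i) = F k b + Y i) (k : ℕ) (t : ℝ) :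
    (ρ k).toOuterMeasure {b | t ≤ ‖F k b‖} ≤
      ENNReal.ofReal (2 * Real.exp (k * ∑ i, (p i).toReal * ‖Y i‖ ^ 2 - t)) := by
  have h1 := mul_toOuterMeasure_le (ρ k) (c := ENNReal.ofReal (Real.exp t / 2))
    (g := fun b => ENNReal.ofReal (Real.cosh ‖F k b‖)) (s := {b | t ≤ ‖F k b‖})
    fun b (hb : t ≤ ‖F k b‖) => ENNReal.ofReal_le_ofReal <| by
      rw [Real.cosh_eq]
      linarith [Real.exp_le_exp.2 hb, Real.exp_pos (-‖F k b‖)]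
  have h2 := h1.trans (tsum_chain_mul_cosh_le hY0 hY1 hρ0 hρ hF0 hF k)
  rw [mul_comm, ← ENNReal.le_div_iff_mul_le (.inl (by simp [Real.exp_pos])) (.inl (by simp)),
    ← ENNReal.ofReal_div_of_pos (by positivity)] at h2
  refine h2.trans_eq ?_
  rw [Real.exp_sub]
  field_simp

/-- Bernstein's inequality for sums of independent bounded vectors, in the unnormalized form in
which the steps are `X i - 𝔼 X`. The parameter `l` is the free one of Chernoff's method. -/
lemma toOuterMeasure_deviation_le {X : ι → H} {B v l : ℝ} (hB : ∀ i, ‖X i‖ ≤ B)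
    (hv : ∑ i, (p i).toReal * ‖X i‖ ^ 2 ≤ v) (hl : 0 < l) (hlB : l * (2 * B) ≤ 1)
    {b₀ : β} (hρ0 : ρ 0 = PMF.pure b₀) (hρ : ∀ k, ρ (k + 1) = (ρ k).bind fun b => p.map (f b))
    {S : β → H} (hS0 : S b₀ = 0) (hS : ∀ b i, S (f b i) = S b + X i) (k : ℕ) (t : ℝ) :
    (ρ k).toOuterMeasure {b | t ≤ ‖S b - (k : ℝ) • ∑ i, (p i).toReal • X i‖} ≤
      ENNReal.ofReal (2 * Real.exp (k * (l ^ 2 * v) - l * t)) := by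
  set M := ∑ i, (p i).toReal • X i with hM
  have hp := sum_toReal_eq_one p
  have hp0 (i : ι) : 0 ≤ (p i).toReal := ENNReal.toReal_nonneg
  have hY0 : ∑ i, (p i).toReal • (l • (X i - M)) = 0 := by
    simp_rw [smul_comm _ l]
    rw [← Finset.smul_sum]
    simp_rw [smul_sub]
    rw [Finset.sum_sub_distrib, ← hM, ← Finset.sum_smul, hp, one_smul, sub_self, smul_zero]
  have hY1 (i : ι) : ‖l • (X i - M)‖ ≤ 1 := by
    rw [norm_smul, Real.norm_of_nonneg hl.le]
    refine le_trans (mul_le_mul_of_nonneg_left ?_ hl.le) hlB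
    linarith [norm_sub_le (X i) M, hB i, norm_mean_le hp0 hp hB]
  have hvar : ∑ i, (p i).toReal * ‖l • (X i - M)‖ ^ 2 ≤ l ^ 2 * v := by
    simp_rw [norm_smul, mul_pow, Real.norm_of_nonneg hl.le, mul_left_comm _ (l ^ 2)]
    rw [← Finset.mul_sum]
    exact mul_le_mul_of_nonneg_left ((sum_norm_sub_mean_sq_le hp X).trans hv) (sq_nonneg l)
  have h := toOuterMeasure_chain_le (F := fun k b => l • (S b - (k : ℝ) • M)) hY0 hY1 hρ0 hρ
    (by simp [hS0]) (fun k b i => by rw [hS]; push_cast; module) k (l * t)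
  have h' := h.trans (ENNReal.ofReal_le_ofReal (mul_le_mul_of_nonneg_left (Real.exp_le_exp.2
    (sub_le_sub_right (mul_le_mul_of_nonneg_left hvar k.cast_nonneg) (l * t))) zero_le_two))
  simpa only [norm_smul l, Real.norm_of_nonneg hl.le, mul_le_mul_iff_right₀ hl] using h'

end Chain

section Graph

variable {V : Type*} [Fintype V] [DecidableEq V]

/-! ### The Frobenius norm -/

lemma frobenius_norm_sq (M : Matrix V V ℝ) : ‖M‖ ^ 2 = ∑ x, ∑ y, M x y ^ 2 := by
  rw [Matrix.frobenius_norm_def, ← Real.sqrt_eq_rpow, Real.sq_sqrt (by positivity)]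
  simp

/-- Matrices with the Frobenius norm as vectors of a Euclidean space. -/
def toEuclidean : Matrix V V ℝ →ₗ[ℝ] EuclideanSpace ℝ (V × V) where
  toFun M := WithLp.toLp 2 fun s => M s.1 s.2
  map_add' _ _ := rfl
  map_smul' _ _ := rfl

lemma norm_toEuclidean (M : Matrix V V ℝ) : ‖toEuclidean M‖ = ‖M‖ := by
  rw [← sq_eq_sq₀ (norm_nonneg _) (norm_nonneg _), EuclideanSpace.norm_sq_eq, frobenius_norm_sq,
    Fintype.sum_prod_type]
  simp_rw [Real.norm_eq_abs, sq_abs]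
  rfl

lemma norm_le_of_mem_rowStochastic {M : Matrix V V ℝ} (hM : M ∈ Matrix.rowStochastic ℝ V) :
    ‖M‖ ≤ √(Fintype.card V) := by
  refine Real.le_sqrt_of_sq_le ?_
  rw [frobenius_norm_sq, ← nsmul_one, ← Finset.card_univ, ← Finset.sum_const]
  refine Finset.sum_le_sum fun x _ => ?_
  rw [← Matrix.sum_row_of_mem_rowStochastic hM x]
  refine Finset.sum_le_sum fun y _ => ?_
  rw [sq]
  exact mul_le_of_le_one_left (Matrix.nonneg_of_mem_rowStochastic hM)
    (Matrix.le_one_of_mem_rowStochastic hM)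

/-! ### The transition matrix -/

variable {G : SimpleGraph V} [DecidableRel G.Adj]

lemma inv_degMatrix (hG : ∀ v, 0 < G.degree v) :
    (G.degMatrix ℝ)⁻¹ = Matrix.diagonal fun v => (G.degree v : ℝ)⁻¹ := by
  refine Matrix.inv_eq_left_inv ?_
  rw [SimpleGraph.degMatrix, Matrix.diagonal_mul_diagonal, ← Matrix.diagonal_one]
  congr 1
  funext v
  exact inv_mul_cancel₀ (Nat.cast_ne_zero.2 (hG v).ne')

lemma transitionMatrix_apply (hG : ∀ v, 0 < G.degree v) (x y : V) :
    transitionMatrix G x y = (G.degree x : ℝ)⁻¹ * G.adjMatrix ℝ x y := by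
  rw [transitionMatrix, inv_degMatrix hG, Matrix.diagonal_mul]

lemma degree_mul_transitionMatrix (hG : ∀ v, 0 < G.degree v) (x y : V) :
    G.degree x * transitionMatrix G x y = G.adjMatrix ℝ x y := by
  rw [transitionMatrix_apply hG, mul_inv_cancel_left₀ (Nat.cast_ne_zero.2 (hG x).ne')]

lemma transitionMatrix_mem_rowStochastic (hG : ∀ v, 0 < G.degree v) :
    transitionMatrix G ∈ Matrix.rowStochastic ℝ V := by
  rw [Matrix.mem_rowStochastic_iff_sum]
  refine ⟨fun x y => ?_, fun x => ?_⟩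
  · rw [transitionMatrix_apply hG, SimpleGraph.adjMatrix_apply]
    split_ifs <;> positivity
  · simp_rw [transitionMatrix_apply hG]
    rw [← Finset.mul_sum]
    simp only [SimpleGraph.adjMatrix_apply, Finset.sum_boole]
    rw [← SimpleGraph.neighborFinset_eq_filter, SimpleGraph.card_neighborFinset_eq_degree]
    exact inv_mul_cancel₀ (Nat.cast_ne_zero.2 (hG x).ne')

lemma transitionMatrix_pow_mem (hG : ∀ v, 0 < G.degree v) (k : ℕ) :
    transitionMatrix G ^ k ∈ Matrix.rowStochastic ℝ V :=
  pow_mem (transitionMatrix_mem_rowStochastic hG) k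

lemma transitionMatrix_pow_nonneg (hG : ∀ v, 0 < G.degree v) (k : ℕ) (x y : V) :
    0 ≤ (transitionMatrix G ^ k) x y :=
  Matrix.nonneg_of_mem_rowStochastic (transitionMatrix_pow_mem hG k)

lemma degMatrix_mul_transitionMatrix (hG : ∀ v, 0 < G.degree v) :
    G.degMatrix ℝ * transitionMatrix G = G.adjMatrix ℝ := by
  ext x y
  rw [SimpleGraph.degMatrix, Matrix.diagonal_mul, degree_mul_transitionMatrix hG]

/-- Reversibility of the random walk with respect to the degrees. -/
lemma transpose_pow_mul_degMatrix (hG : ∀ v, 0 < G.degree v) (k : ℕ) :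
    (transitionMatrix G ^ k).transpose * G.degMatrix ℝ =
      G.degMatrix ℝ * transitionMatrix G ^ k := by
  have h1 : (transitionMatrix G).transpose * G.degMatrix ℝ =
      G.degMatrix ℝ * transitionMatrix G := by
    rw [degMatrix_mul_transitionMatrix hG, ← (G.isSymm_degMatrix ℝ).eq, ← Matrix.transpose_mul,
      degMatrix_mul_transitionMatrix hG, G.transpose_adjMatrix]
  induction k with
  | zero => simp
  | succ k ih =>
    rw [pow_succ, Matrix.transpose_mul, Matrix.mul_assoc, ih, ← Matrix.mul_assoc, h1,
      Matrix.mul_assoc, ← pow_succ', pow_succ]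

lemma degree_mul_pow_comm (hG : ∀ v, 0 < G.degree v) (k : ℕ) (x y : V) :
    G.degree x * (transitionMatrix G ^ k) x y = G.degree y * (transitionMatrix G ^ k) y x := by
  have h := congrFun₂ (transpose_pow_mul_degMatrix hG k) x y
  rw [SimpleGraph.degMatrix, Matrix.diagonal_mul, Matrix.mul_diagonal, Matrix.transpose_apply] at h
  rw [← h, mul_comm]

/-- Stationarity: a uniformly random edge, extended by `k` steps backwards and `l` steps forwards,
is a stationary walk of length `k + l + 1`. -/
lemma sum_adj_mul_pow_mul_pow (hG : ∀ v, 0 < G.degree v) (k l : ℕ) (a b : V) :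
    ∑ u, ∑ v, G.adjMatrix ℝ u v *
        ((transitionMatrix G ^ k) u a * (transitionMatrix G ^ l) v b) =
      G.degree a * (transitionMatrix G ^ (k + l + 1)) a b := by
  have h : (transitionMatrix G ^ k).transpose * (G.adjMatrix ℝ * transitionMatrix G ^ l) =
      G.degMatrix ℝ * transitionMatrix G ^ (k + l + 1) := by
    rw [← degMatrix_mul_transitionMatrix hG, Matrix.mul_assoc, ← pow_succ', ← Matrix.mul_assoc,
      transpose_pow_mul_degMatrix hG, Matrix.mul_assoc, ← pow_add, add_assoc]
  have h' := congrFun₂ h a b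
  rw [SimpleGraph.degMatrix, Matrix.diagonal_mul] at h'
  rw [← h', Matrix.mul_apply]
  simp_rw [Matrix.mul_apply, Finset.mul_sum, Matrix.transpose_apply]
  exact Finset.sum_congr rfl fun u _ => Finset.sum_congr rfl fun v _ => by ring

lemma sum_dart (f : V → V → ℝ) :
    ∑ e : G.Dart, f e.fst e.snd = ∑ u, ∑ v, G.adjMatrix ℝ u v * f u v := by
  have h : (Finset.univ : Finset G.Dart).image (fun e => e.toProd) =
      Finset.univ.filter fun s : V × V => G.Adj s.1 s.2 := by
    ext s
    simp only [Finset.mem_image, Finset.mem_univ, true_and, Finset.mem_filter]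
    exact ⟨fun ⟨e, he⟩ => he ▸ e.adj, fun hs => ⟨⟨s, hs⟩, rfl⟩⟩
  rw [← Fintype.sum_prod_type' (f := fun u v => G.adjMatrix ℝ u v * f u v)]
  simp only [SimpleGraph.adjMatrix_apply, ite_mul, one_mul, zero_mul]
  rw [← Finset.sum_filter, ← h, Finset.sum_image fun e _ e' _ he => SimpleGraph.Dart.ext _ _ he]

/-! ### The law of the sampled endpoints -/

lemma bind_congr_support {β γ : Type*} (p : PMF β) {f g : β → PMF γ}
    (h : ∀ b ∈ p.support, f b = g b) : p.bind f = p.bind g := by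
  ext c
  rw [PMF.bind_apply, PMF.bind_apply]
  refine tsum_congr fun b => ?_
  by_cases hb : b ∈ p.support
  · rw [h b hb]
  · rw [(p.apply_eq_zero_iff b).2 hb, zero_mul, zero_mul]

lemma toReal_bind_apply {ι γ : Type*} [Fintype ι] (p : PMF ι) (f : ι → PMF γ) (c : γ) :
    (p.bind f c).toReal = ∑ i, (p i).toReal * (f i c).toReal := by
  rw [PMF.bind_apply, tsum_fintype, ENNReal.toReal_sum fun i _ =>
    ENNReal.mul_ne_top (p.apply_ne_top i) ((f i).apply_ne_top c)]
  simp_rw [ENNReal.toReal_mul]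

/-- The endpoint of a `k`-step random walk. -/
noncomputable def walkEnd (G : SimpleGraph V) [DecidableRel G.Adj] : ℕ → V → PMF V
  | 0, v => PMF.pure v
  | k + 1, v => (step G v).bind fun w => walkEnd G k w

/-- The path weights are deterministic: every edge of the unweighted graph contributes `2`. -/
lemma walk_eq_map {V : Type*} [Fintype V] {G : SimpleGraph V} [DecidableRel G.Adj]
    (hG : ∀ v, 0 < G.degree v) (k : ℕ) (v : V) :
    walk G k v = (walkEnd G k v).map fun w => (w, 2 * (k : ℝ)) := by
  induction k generalizing v with
  | zero => simp [walk, walkEnd, PMF.pure_map]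
  | succ k ih =>
    rw [walk, walkEnd, PMF.map_bind]
    refine bind_congr_support _ fun w hw => ?_
    have hadj : G.Adj v w := by
      rw [step, dif_pos (Finset.card_pos.1 (hG v)), PMF.mem_support_uniformOfFinset_iff,
        SimpleGraph.mem_neighborFinset] at hw
      exact hw
    rw [ih, PMF.bind_map, ← PMF.bind_pure_comp]
    congr 1
    funext x
    simp only [Function.comp_apply, SimpleGraph.adjMatrix_apply, hadj, if_true]
    congr 2
    push_cast
    ring

lemma toReal_step_apply (hG : ∀ v, 0 < G.degree v) (v w : V) :
    (step G v w).toReal = transitionMatrix G v w := by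
  rw [step, dif_pos (Finset.card_pos.1 (hG v)), transitionMatrix_apply hG,
    PMF.uniformOfFinset_apply, SimpleGraph.adjMatrix_apply]
  by_cases h : G.Adj v w <;> simp [h]

lemma toReal_walkEnd_apply (hG : ∀ v, 0 < G.degree v) (k : ℕ) (v w : V) :
    (walkEnd G k v w).toReal = (transitionMatrix G ^ k) v w := by
  induction k generalizing v with
  | zero => simp [walkEnd, PMF.pure_apply, Matrix.one_apply, eq_comm, apply_ite]
  | succ k ih =>
    rw [walkEnd, toReal_bind_apply, pow_succ', Matrix.mul_apply]
    simp_rw [ih, toReal_step_apply hG]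

/-- The joint law of the two endpoints `(n₀, n_r)` of a sampled path. -/
noncomputable def endpointLaw (G : SimpleGraph V) [DecidableRel G.Adj] [Nonempty G.Dart] {α : ℝ}
    {T : ℕ} (hα : α ∈ Set.Ioo (0 : ℝ) 1) (hT : 1 ≤ T) : PMF (V × V) :=
  (PMF.uniformOfFintype G.Dart).bind fun e =>
    (pathLength hα hT).bind fun i =>
      (PMF.uniformOfFintype (Fin (i.val + 1))).bind fun k =>
        (walkEnd G k.val e.fst).bind fun a =>
          (walkEnd G (i.val - k.val) e.snd).map fun b => (a, b)

/-- Since `Z_p = 2 r`, every sample adds the same weight `m / N`. -/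
lemma addSample_eq_map [Nonempty G.Dart] (hG : ∀ v, 0 < G.degree v) {α : ℝ} {T : ℕ}
    (hα : α ∈ Set.Ioo (0 : ℝ) 1) (hT : 1 ≤ T) (N : ℕ) (W : Matrix V V ℝ) :
    addSample G hα hT N W = (endpointLaw G hα hT).map fun s =>
      addEdge W s.1 s.2 ((G.edgeFinset.card : ℝ) / N) := by
  simp only [addSample, endpointLaw, pathSampling, walk_eq_map hG, PMF.map_bind, PMF.bind_bind,
    PMF.bind_map, PMF.map_comp, PMF.pure_bind, Function.comp_def, Nat.add_sub_cancel]
  congr 1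
  funext e
  congr 1
  funext i
  congr 1
  funext k
  congr 1
  funext a
  rw [← PMF.bind_pure_comp]
  congr 1
  funext b
  have hk : (k.val : ℝ) + (i.val - k.val : ℕ) = i.val := by
    rw [← Nat.cast_add, Nat.add_sub_cancel' (Nat.lt_succ_iff.1 k.isLt)]
  have hZ : 2 * (k.val : ℝ) + 2 / G.adjMatrix ℝ e.fst e.snd + 2 * (i.val - k.val : ℕ) =
      2 * ((i.val + 1 : ℕ) : ℝ) := by
    rw [SimpleGraph.adjMatrix_apply, if_pos e.adj]
    push_cast
    linarith
  rw [hZ, mul_comm (N : ℝ), mul_div_mul_left]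
  · rfl
  · positivity

/-- The mixture of powers `∑_{r = 1}^T (α (1 - α)^r / α_sum) P^r`. -/
noncomputable def mixedTransition (G : SimpleGraph V) [DecidableRel G.Adj] (α : ℝ) (T : ℕ) :
    Matrix V V ℝ :=
  ∑ i : Fin T, (α * (1 - α) ^ (i.val + 1) / alphaSum α T) • transitionMatrix G ^ (i.val + 1)

lemma mixedTransition_apply (α : ℝ) (T : ℕ) (x y : V) :
    mixedTransition G α T x y = ∑ i : Fin T,
      α * (1 - α) ^ (i.val + 1) / alphaSum α T * (transitionMatrix G ^ (i.val + 1)) x y := by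
  simp [mixedTransition, Matrix.sum_apply]

lemma truncatedPPR_eq {α : ℝ} {T : ℕ} (hα : α ∈ Set.Ioo (0 : ℝ) 1) (hT : 1 ≤ T) :
    truncatedPPR G α T = α • (1 : Matrix V V ℝ) + alphaSum α T • mixedTransition G α T := by
  rw [truncatedPPR, Finset.sum_range_succ', mixedTransition, Finset.smul_sum,
    ← Fin.sum_univ_eq_sum_range (fun i => (α * (1 - α) ^ (i + 1)) • transitionMatrix G ^ (i + 1)),
    add_comm]
  congr 1
  · simp
  · refine Finset.sum_congr rfl fun i _ => ?_
    rw [smul_smul, mul_div_cancel₀ _ (alphaSum_pos hα hT).ne']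

lemma toReal_pathLength_apply {α : ℝ} {T : ℕ} (hα : α ∈ Set.Ioo (0 : ℝ) 1) (hT : 1 ≤ T)
    (i : Fin T) :
    (pathLength hα hT i).toReal = α * (1 - α) ^ (i.val + 1) / alphaSum α T := by
  rw [pathLength, PMF.ofFintype_apply, ENNReal.toReal_ofReal]
  exact div_nonneg (mul_nonneg hα.1.le (pow_nonneg (sub_nonneg.2 hα.2.le) _))
    (alphaSum_pos hα hT).le

lemma mixedTransition_mem_rowStochastic (hG : ∀ v, 0 < G.degree v) {α : ℝ} {T : ℕ}
    (hα : α ∈ Set.Ioo (0 : ℝ) 1) (hT : 1 ≤ T) :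
    mixedTransition G α T ∈ Matrix.rowStochastic ℝ V := by
  rw [Matrix.mem_rowStochastic_iff_sum]
  simp_rw [mixedTransition_apply, ← toReal_pathLength_apply hα hT]
  refine ⟨fun x y => Finset.sum_nonneg fun i _ =>
    mul_nonneg ENNReal.toReal_nonneg (transitionMatrix_pow_nonneg hG _ x y), fun x => ?_⟩
  rw [Finset.sum_comm]
  simp_rw [← Finset.mul_sum, Matrix.sum_row_of_mem_rowStochastic (transitionMatrix_pow_mem hG _) x,
    mul_one]
  exact sum_toReal_eq_one _

lemma degree_mul_mixedTransition_comm (hG : ∀ v, 0 < G.degree v) (α : ℝ) (T : ℕ) (x y : V) :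
    G.degree x * mixedTransition G α T x y = G.degree y * mixedTransition G α T y x := by
  simp_rw [mixedTransition_apply, Finset.mul_sum, mul_left_comm (G.degree _ : ℝ),
    degree_mul_pow_comm hG _ x y]

lemma toReal_walkEnd_pair_apply (hG : ∀ v, 0 < G.degree v) (k l : ℕ) (u v a b : V) :
    (((walkEnd G k u).bind fun x => (walkEnd G l v).map fun y => (x, y)) (a, b)).toReal =
      (transitionMatrix G ^ k) u a * (transitionMatrix G ^ l) v b := by
  rw [toReal_bind_apply, Finset.sum_eq_single a]
  · rw [← toReal_walkEnd_apply hG, ← toReal_walkEnd_apply hG, PMF.map_apply,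
      tsum_eq_single b fun y hy => by simp [hy.symm]]
    simp
  · intro x _ hx
    rw [PMF.map_apply]
    simp [hx.symm]
  · simp

/-- The law of the endpoints is that of a stationary random walk whose length is random. -/
lemma toReal_endpointLaw_apply [Nonempty G.Dart] (hG : ∀ v, 0 < G.degree v) {α : ℝ} {T : ℕ}
    (hα : α ∈ Set.Ioo (0 : ℝ) 1) (hT : 1 ≤ T) (a b : V) :
    (endpointLaw G hα hT (a, b)).toReal =
      G.degree a * mixedTransition G α T a b / (2 * G.edgeFinset.card) := by
  simp_rw [endpointLaw, toReal_bind_apply (PMF.uniformOfFintype G.Dart),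
    toReal_bind_apply (pathLength hα hT), toReal_bind_apply (PMF.uniformOfFintype (Fin _)),
    toReal_walkEnd_pair_apply hG, toReal_pathLength_apply hα hT, PMF.uniformOfFintype_apply,
    ENNReal.toReal_inv, ENNReal.toReal_natCast, Fintype.card_fin,
    SimpleGraph.dart_card_eq_twice_card_edges]
  rw [← Finset.mul_sum, Finset.sum_comm, mixedTransition_apply, div_eq_inv_mul]
  push_cast
  congr 1
  rw [Finset.mul_sum]
  refine Finset.sum_congr rfl fun i _ => ?_
  rw [← Finset.mul_sum, mul_left_comm]
  congr 1
  rw [Finset.sum_comm]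
  have h (k : Fin (i.val + 1)) : ∑ e : G.Dart, ((i.val : ℝ) + 1)⁻¹ *
      ((transitionMatrix G ^ k.val) e.fst a * (transitionMatrix G ^ (i.val - k.val)) e.snd b) =
      ((i.val : ℝ) + 1)⁻¹ * (G.degree a * (transitionMatrix G ^ (i.val + 1)) a b) := by
    rw [← Finset.mul_sum, sum_dart fun u v =>
      (transitionMatrix G ^ k.val) u a * (transitionMatrix G ^ (i.val - k.val)) v b,
      sum_adj_mul_pow_mul_pow hG, Nat.add_sub_cancel' (Nat.lt_succ_iff.1 k.isLt)]
  simp_rw [h]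
  rw [Finset.sum_const, Finset.card_univ, Fintype.card_fin, nsmul_eq_mul]
  push_cast
  rw [mul_inv_cancel_left₀ (by positivity)]

end Graph

section Sparsifier

variable {V : Type*} [Fintype V] [DecidableEq V]

/-! ### Laplacians of single edges -/

/-- The Laplacian `(e_a - e_b) (e_a - e_b)ᵀ` of the edge `{a, b}`; it vanishes for a loop. -/
def edgeLaplacian (a b : V) : Matrix V V ℝ :=
  Matrix.vecMulVec (Pi.single a 1 - Pi.single b 1) (Pi.single a 1 - Pi.single b 1)

lemma edgeLaplacian_apply {V : Type*} [DecidableEq V] (a b x y : V) :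
    edgeLaplacian a b x y = ((if x = a then 1 else 0) - if x = b then 1 else 0) *
      ((if y = a then 1 else 0) - if y = b then 1 else 0) := by
  simp [edgeLaplacian, Matrix.vecMulVec_apply, Pi.single_apply]

lemma weightedLaplacian_addEdge (W : Matrix V V ℝ) (a b : V) (w : ℝ) :
    weightedLaplacian (addEdge W a b w) = weightedLaplacian W + w • edgeLaplacian a b := by
  have hW : addEdge W a b w = W + w • addEdge 0 a b 1 := by
    ext x y
    simp only [addEdge, Matrix.of_apply, Matrix.add_apply, Matrix.smul_apply, Matrix.zero_apply]
    split_ifs <;> simp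
  have hadd : weightedLaplacian (W + w • addEdge 0 a b 1) =
      weightedLaplacian W + w • weightedLaplacian (addEdge 0 a b 1) := by
    ext x y
    simp only [weightedLaplacian, Matrix.sub_apply, Matrix.add_apply, Matrix.smul_apply,
      Matrix.diagonal_apply, Finset.sum_add_distrib, smul_eq_mul, ← Finset.mul_sum]
    split_ifs <;> ring
  have hone : weightedLaplacian (addEdge 0 a b 1) = edgeLaplacian a b := by
    ext x y
    rw [edgeLaplacian_apply]
    simp only [weightedLaplacian, addEdge, Matrix.sub_apply, Matrix.diagonal_apply,
      Matrix.of_apply, Matrix.zero_apply, zero_add, Sym2.eq_iff]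
    by_cases hab : a = b
    · subst hab
      by_cases hxa : x = a <;> by_cases hxy : x = y <;> simp_all [eq_comm]
    · by_cases hxa : x = a
      · by_cases hxy : x = y <;> by_cases hyb : y = b <;> simp_all [eq_comm]
      · by_cases hxb : x = b
        · by_cases hxy : x = y <;> by_cases hya : y = a <;> simp_all [eq_comm]
        · by_cases hxy : x = y
          · subst hxy; simp_all
          · simp_all
  rw [hW, hadd, hone]

variable {G : SimpleGraph V} [DecidableRel G.Adj]

/-- The contribution `m D⁻¹ (e_a - e_b) (e_a - e_b)ᵀ` of a sample with endpoints `a`, `b` to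
`N D⁻¹ L̃`. -/
noncomputable def sampleMatrix (G : SimpleGraph V) [DecidableRel G.Adj] (s : V × V) :
    Matrix V V ℝ :=
  (G.edgeFinset.card : ℝ) • ((G.degMatrix ℝ)⁻¹ * edgeLaplacian s.1 s.2)

lemma norm_sampleMatrix_sq_le (hG : ∀ v, 0 < G.degree v) (s : V × V) :
    ‖sampleMatrix G s‖ ^ 2 ≤ 2 * (G.edgeFinset.card : ℝ) ^ 2 *
      ((G.degree s.1 : ℝ)⁻¹ + (G.degree s.2 : ℝ)⁻¹) := by
  obtain ⟨a, b⟩ := s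
  set z : V → ℝ := fun x => (if x = a then 1 else 0) - if x = b then 1 else 0 with hz
  have hz2 (x : V) : z x ^ 2 ≤ (if x = a then 1 else 0) + if x = b then 1 else 0 := by
    simp only [hz]; split_ifs <;> norm_num
  have hy : ∑ y, z y ^ 2 ≤ 2 := by
    refine (Finset.sum_le_sum fun y _ => hz2 y).trans_eq ?_
    rw [Finset.sum_add_distrib]
    simp
    norm_num
  have hx : ∑ x, (G.degree x : ℝ)⁻¹ ^ 2 * z x ^ 2 ≤
      (G.degree a : ℝ)⁻¹ + (G.degree b : ℝ)⁻¹ := by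
    calc _ ≤ ∑ x, (G.degree x : ℝ)⁻¹ * ((if x = a then 1 else 0) + if x = b then 1 else 0) :=
          Finset.sum_le_sum fun x _ => by
            have h1 : (G.degree x : ℝ)⁻¹ ≤ 1 := inv_le_one_of_one_le₀ (by exact_mod_cast hG x)
            have h2 : (G.degree x : ℝ)⁻¹ ^ 2 ≤ (G.degree x : ℝ)⁻¹ :=
              pow_le_of_le_one (by positivity) h1 two_ne_zero
            exact mul_le_mul h2 (hz2 x) (sq_nonneg _) (by positivity)
      _ = _ := by simp [mul_add, Finset.sum_add_distrib]
  have hentry (x y : V) : sampleMatrix G (a, b) x y ^ 2 = (G.edgeFinset.card : ℝ) ^ 2 *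
      ((G.degree x : ℝ)⁻¹ ^ 2 * z x ^ 2) * z y ^ 2 := by
    rw [sampleMatrix, Matrix.smul_apply, inv_degMatrix hG, Matrix.diagonal_mul,
      edgeLaplacian_apply, smul_eq_mul]
    ring
  rw [frobenius_norm_sq]
  simp_rw [hentry, ← Finset.mul_sum]
  rw [← Finset.sum_mul, ← Finset.mul_sum]
  calc _ ≤ (G.edgeFinset.card : ℝ) ^ 2 * ((G.degree a : ℝ)⁻¹ + (G.degree b : ℝ)⁻¹) * 2 := by
        gcongr
    _ = _ := by ring

lemma norm_sampleMatrix_le (hG : ∀ v, 0 < G.degree v) (s : V × V) :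
    ‖sampleMatrix G s‖ ≤ 2 * (G.edgeFinset.card : ℝ) := by
  refine abs_le_of_sq_le_sq' ?_ (by positivity) |>.2
  have h (v : V) : (G.degree v : ℝ)⁻¹ ≤ 1 := inv_le_one_of_one_le₀ (by exact_mod_cast hG v)
  calc _ ≤ _ := norm_sampleMatrix_sq_le hG s
    _ ≤ 2 * (G.edgeFinset.card : ℝ) ^ 2 * (1 + 1) := by gcongr <;> exact h _
    _ = _ := by ring

/-! ### Mean and second moment of a sample -/

section Moments

variable [Nonempty G.Dart] {α : ℝ} {T : ℕ} (hα : α ∈ Set.Ioo (0 : ℝ) 1) (hT : 1 ≤ T)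

lemma card_edgeFinset_pos {V : Type*} [Fintype V] (G : SimpleGraph V) [DecidableRel G.Adj]
    [Nonempty G.Dart] :
    0 < (G.edgeFinset.card : ℝ) := by
  have h := Fintype.card_pos (α := G.Dart)
  rw [SimpleGraph.dart_card_eq_twice_card_edges] at h
  exact_mod_cast (by omega : 0 < G.edgeFinset.card)

lemma toReal_endpointLaw_swap (hG : ∀ v, 0 < G.degree v) (a b : V) :
    (endpointLaw G hα hT (b, a)).toReal = (endpointLaw G hα hT (a, b)).toReal := by
  rw [toReal_endpointLaw_apply hG, toReal_endpointLaw_apply hG,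
    degree_mul_mixedTransition_comm hG]

/-- Each endpoint has the stationary distribution `d / (2 m)`. -/
lemma sum_toReal_endpointLaw (hG : ∀ v, 0 < G.degree v) (a : V) :
    ∑ b, (endpointLaw G hα hT (a, b)).toReal = G.degree a / (2 * G.edgeFinset.card) := by
  simp_rw [toReal_endpointLaw_apply hG]
  rw [← Finset.sum_div, ← Finset.mul_sum,
    Matrix.sum_row_of_mem_rowStochastic (mixedTransition_mem_rowStochastic hG hα hT), mul_one]

/-- `N D⁻¹ L̃` is an unbiased estimator of `N (I - ∑ᵣ (α (1 - α)^r / α_sum) P^r)`. -/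
lemma sum_smul_sampleMatrix (hG : ∀ v, 0 < G.degree v) :
    ∑ s, (endpointLaw G hα hT s).toReal • sampleMatrix G s = 1 - mixedTransition G α T := by
  have hm := card_edgeFinset_pos G
  ext x y
  have hd : (G.degree x : ℝ) ≠ 0 := Nat.cast_ne_zero.2 (hG x).ne'
  set q : V → V → ℝ := fun a b => (endpointLaw G hα hT (a, b)).toReal with hq
  have hcol : ∑ a, q a x = G.degree x / (2 * G.edgeFinset.card) := by
    rw [← sum_toReal_endpointLaw hα hT hG x]
    exact Finset.sum_congr rfl fun a _ => toReal_endpointLaw_swap hα hT hG x a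
  have hrow : ∑ b, q x b = G.degree x / (2 * G.edgeFinset.card) :=
    sum_toReal_endpointLaw hα hT hG x
  have hexp : ∑ a, ∑ b, q a b * edgeLaplacian a b x y =
      (if x = y then ∑ b, q x b else 0) - q x y - q y x + if x = y then ∑ a, q a x else 0 := by
    have h (a b : V) : q a b * edgeLaplacian a b x y =
        (if x = a then if y = a then q a b else 0 else 0) -
        (if x = a then if y = b then q a b else 0 else 0) -
        (if y = a then if x = b then q a b else 0 else 0) +
        (if x = b then if y = b then q a b else 0 else 0) := by
      rw [edgeLaplacian_apply]
      split_ifs <;> ring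
    simp_rw [h, Finset.sum_add_distrib, Finset.sum_sub_distrib]
    rw [Finset.sum_comm (f := fun a b => if x = b then if y = b then q a b else 0 else 0),
      Finset.sum_comm (f := fun a b => if x = a then if y = a then q a b else 0 else 0)]
    simp [Finset.sum_ite_irrel, eq_comm]
  have hentry : (∑ s, (endpointLaw G hα hT s).toReal • sampleMatrix G s) x y =
      G.edgeFinset.card * ((G.degree x : ℝ)⁻¹ * ∑ a, ∑ b, q a b * edgeLaplacian a b x y) := by
    rw [Matrix.sum_apply, Fintype.sum_prod_type]
    simp_rw [Finset.mul_sum]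
    refine Finset.sum_congr rfl fun a _ => Finset.sum_congr rfl fun b _ => ?_
    rw [Matrix.smul_apply, sampleMatrix, Matrix.smul_apply, inv_degMatrix hG, Matrix.diagonal_mul,
      smul_eq_mul, smul_eq_mul]
    ring
  have hsymm : q y x = q x y := toReal_endpointLaw_swap hα hT hG x y
  rw [hentry, hexp, hrow, hcol, hsymm, Matrix.sub_apply, Matrix.one_apply]
  simp only [hq, toReal_endpointLaw_apply hG]
  split_ifs <;> field_simp <;> ring

lemma sum_norm_sampleMatrix_sq_le (hG : ∀ v, 0 < G.degree v) :
    ∑ s, (endpointLaw G hα hT s).toReal * ‖sampleMatrix G s‖ ^ 2 ≤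
      2 * G.edgeFinset.card * Fintype.card V := by
  have hm := card_edgeFinset_pos G
  have hterm (a : V) : (∑ b, (endpointLaw G hα hT (a, b)).toReal) * (G.degree a : ℝ)⁻¹ =
      (2 * (G.edgeFinset.card : ℝ))⁻¹ := by
    have hd : (G.degree a : ℝ) ≠ 0 := Nat.cast_ne_zero.2 (hG a).ne'
    rw [sum_toReal_endpointLaw hα hT hG]
    field_simp
  have h1 : ∑ s : V × V, (endpointLaw G hα hT s).toReal * (G.degree s.1 : ℝ)⁻¹ =
      Fintype.card V * (2 * (G.edgeFinset.card : ℝ))⁻¹ := by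
    rw [Fintype.sum_prod_type]
    refine (Finset.sum_congr rfl fun a _ =>
      (Finset.sum_mul _ _ _).symm.trans (hterm a)).trans ?_
    rw [Finset.sum_const, Finset.card_univ, nsmul_eq_mul]
  have h2 : ∑ s : V × V, (endpointLaw G hα hT s).toReal * (G.degree s.2 : ℝ)⁻¹ =
      Fintype.card V * (2 * (G.edgeFinset.card : ℝ))⁻¹ := by
    rw [← h1, Fintype.sum_prod_type_right, Fintype.sum_prod_type]
    refine Finset.sum_congr rfl fun a _ => Finset.sum_congr rfl fun b _ => ?_
    rw [toReal_endpointLaw_swap hα hT hG]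
  calc _ ≤ ∑ s, (endpointLaw G hα hT s).toReal * (2 * (G.edgeFinset.card : ℝ) ^ 2 *
        ((G.degree s.1 : ℝ)⁻¹ + (G.degree s.2 : ℝ)⁻¹)) :=
        Finset.sum_le_sum fun s _ =>
          mul_le_mul_of_nonneg_left (norm_sampleMatrix_sq_le hG s) ENNReal.toReal_nonneg
    _ = 2 * (G.edgeFinset.card : ℝ) ^ 2 *
        (∑ s, (endpointLaw G hα hT s).toReal * (G.degree s.1 : ℝ)⁻¹ +
          ∑ s, (endpointLaw G hα hT s).toReal * (G.degree s.2 : ℝ)⁻¹) := by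
        rw [← Finset.sum_add_distrib, Finset.mul_sum]
        exact Finset.sum_congr rfl fun s _ => by ring
    _ = _ := by
        rw [h1, h2]
        field_simp
        ring

/-! ### Concentration of the sampled Laplacian -/

/-- Bernstein's inequality for the sampled graph, for deviations of size `t` of `D⁻¹ L̃`. Both sides
of the event carry the factor `N`, which scales them to a sum of `N` samples. -/
lemma toOuterMeasure_sampledGraph_le (hG : ∀ v, 0 < G.degree v) {N : ℕ} (hN : N ≠ 0) {l : ℝ}
    (hl : 0 < l) (hlm : l * (4 * G.edgeFinset.card) ≤ 1) (t : ℝ) :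
    (sampledGraph G hα hT N N).toOuterMeasure
        {W | N * t ≤ N * ‖(G.degMatrix ℝ)⁻¹ * weightedLaplacian W -
          (1 - mixedTransition G α T)‖} ≤
      ENNReal.ofReal (2 * Real.exp
        (N * (l ^ 2 * (2 * G.edgeFinset.card * Fintype.card V)) - l * (N * t))) := by
  have hN' : (N : ℝ) ≠ 0 := Nat.cast_ne_zero.2 hN
  have h := toOuterMeasure_deviation_le (p := endpointLaw G hα hT)
    (X := fun s => toEuclidean (sampleMatrix G s)) (ρ := sampledGraph G hα hT N) (b₀ := 0)
    (f := fun W s => addEdge W s.1 s.2 ((G.edgeFinset.card : ℝ) / N))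
    (S := fun W => toEuclidean ((N : ℝ) • ((G.degMatrix ℝ)⁻¹ * weightedLaplacian W)))
    (B := 2 * G.edgeFinset.card) (v := 2 * G.edgeFinset.card * Fintype.card V) (l := l)
    (fun s => by rw [norm_toEuclidean]; exact norm_sampleMatrix_le hG s)
    (by simp_rw [norm_toEuclidean]; exact sum_norm_sampleMatrix_sq_le hα hT hG)
    hl (by linarith) rfl
    (fun k => by
      change (sampledGraph G hα hT N k).bind _ = _
      simp_rw [addSample_eq_map hG hα hT N])
    (by simp [weightedLaplacian])
    (fun W s => by
      rw [← map_add, weightedLaplacian_addEdge, sampleMatrix, Matrix.mul_add, Matrix.mul_smul,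
        smul_add, smul_smul, mul_div_cancel₀ _ hN'])
    N (N * t)
  have hmean : ∑ s, (endpointLaw G hα hT s).toReal • toEuclidean (sampleMatrix G s) =
      toEuclidean (1 - mixedTransition G α T) := by
    simp_rw [← sum_smul_sampleMatrix hα hT hG, map_sum, map_smul]
  have hnorm (W : Matrix V V ℝ) :
      ‖toEuclidean ((N : ℝ) • ((G.degMatrix ℝ)⁻¹ * weightedLaplacian W)) -
        (N : ℝ) • toEuclidean (1 - mixedTransition G α T)‖ =
      N * ‖(G.degMatrix ℝ)⁻¹ * weightedLaplacian W - (1 - mixedTransition G α T)‖ := by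
    rw [← map_smul, ← map_sub, norm_toEuclidean, ← smul_sub, norm_smul, Real.norm_natCast]
  simp_rw [hmean, hnorm] at h
  exact h

end Moments

/-! ### Truncation -/

lemma norm_smul_transitionMatrix_pow_le (hG : ∀ v, 0 < G.degree v) {α : ℝ}
    (hα : α ∈ Set.Ioo (0 : ℝ) 1) (r : ℕ) :
    ‖(α * (1 - α) ^ r) • transitionMatrix G ^ r‖ ≤
      α * (1 - α) ^ r * √(Fintype.card V) := by
  have h0 : 0 ≤ α * (1 - α) ^ r := mul_nonneg hα.1.le (pow_nonneg (sub_nonneg.2 hα.2.le) _)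
  rw [norm_smul, Real.norm_of_nonneg h0]
  exact mul_le_mul_of_nonneg_left (norm_le_of_mem_rowStochastic (transitionMatrix_pow_mem hG r)) h0

lemma hasSum_geometric_weights {α : ℝ} (hα : α ∈ Set.Ioo (0 : ℝ) 1) (k : ℕ) (c : ℝ) :
    HasSum (fun r : ℕ => α * (1 - α) ^ (r + k) * c) (c * (1 - α) ^ k) := by
  have h := (hasSum_geometric_of_lt_one (sub_nonneg.2 hα.2.le) (sub_lt_self 1 hα.1)).mul_left
    (α * (1 - α) ^ k * c)
  rw [sub_sub_cancel] at h
  have h1 : α * (1 - α) ^ k * c * α⁻¹ = c * (1 - α) ^ k := by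
    have := hα.1.ne'
    field_simp
  rw [h1] at h
  exact h.congr_fun fun r => by ring

lemma hasSum_pprMatrix (hG : ∀ v, 0 < G.degree v) {α : ℝ} (hα : α ∈ Set.Ioo (0 : ℝ) 1) :
    HasSum (fun r : ℕ => (α * (1 - α) ^ r) • transitionMatrix G ^ r) (pprMatrix G α) :=
  (Summable.of_norm_bounded (hasSum_geometric_weights hα 0 (√(Fintype.card V))).summable
    (norm_smul_transitionMatrix_pow_le hG hα)).hasSum

lemma norm_pprMatrix_sub_truncatedPPR_le (hG : ∀ v, 0 < G.degree v) {α : ℝ}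
    (hα : α ∈ Set.Ioo (0 : ℝ) 1) (T : ℕ) :
    ‖pprMatrix G α - truncatedPPR G α T‖ ≤ √(Fintype.card V) * (1 - α) ^ (T + 1) :=
  ((hasSum_nat_add_iff' (T + 1)).2 (hasSum_pprMatrix hG hα)).norm_le_of_bounded
    (hasSum_geometric_weights hα (T + 1) (√(Fintype.card V)))
    fun r => norm_smul_transitionMatrix_pow_le hG hα (r + (T + 1))

/-! ### The approximation guarantee -/

/-- The numerical choice of parameters: `l = ε / (2 m √n)` and `t = 4 ε √n` turn the exponent of
Bernstein's inequality into `-(3 / 2) N ε² / m ≤ -3 log n`. -/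
lemma two_mul_exp_le_inv {n m N ε : ℝ} (hn : 2 ≤ n) (hm : 0 < m) (hε : 0 < ε)
    (hN : 2 * Real.log n ≤ N * ε ^ 2 / m) :
    2 * Real.exp (N * ((ε / (2 * m * √n)) ^ 2 * (2 * m * n)) -
      ε / (2 * m * √n) * (N * (4 * ε * √n))) ≤ 1 / n := by
  have hn0 : 0 < n := by linarith
  have hs : √n ^ 2 = n := Real.sq_sqrt hn0.le
  have hs0 : 0 < √n := Real.sqrt_pos.2 hn0
  have hexp : N * ((ε / (2 * m * √n)) ^ 2 * (2 * m * n)) -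
      ε / (2 * m * √n) * (N * (4 * ε * √n)) = -(3 / 2) * (N * ε ^ 2 / m) := by
    rw [div_pow, mul_pow, hs]
    field_simp
    ring
  rw [hexp]
  have h1 : Real.exp (-(3 / 2) * (N * ε ^ 2 / m)) ≤ (n ^ 3)⁻¹ := by
    rw [← Real.exp_log (pow_pos hn0 3), ← Real.exp_neg, Real.log_pow]
    refine Real.exp_le_exp.2 ?_
    push_cast
    linarith
  refine (mul_le_mul_of_nonneg_left h1 zero_le_two).trans ?_
  rw [← div_eq_mul_inv, div_le_div_iff₀ (by positivity) hn0]
  nlinarith [mul_nonneg hn0.le (show 0 ≤ n ^ 2 - 2 by nlinarith)]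

end Sparsifier

end PPRSparsifier

theorem theorem4 :
    ∃ C : ℝ, 0 < C ∧
      ∀ (V : Type*) [Fintype V] [DecidableEq V] (G : SimpleGraph V) [DecidableRel G.Adj]
        [Nonempty G.Dart], (∀ v : V, 0 < G.degree v) →
      ∀ (α : ℝ) (hα : α ∈ Set.Ioo (0 : ℝ) 1) (T : ℕ) (hT : 1 ≤ T) (ε : ℝ),
        0 < ε → ε ≤ 1 / 2 →
      ∀ N : ℕ,
        C * T * G.edgeFinset.card * Real.log (Fintype.card V) / ε ^ 2 ≤ N →
        HasSum (fun r : ℕ => (α * (1 - α) ^ r) • PPRSparsifier.transitionMatrix G ^ r)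
            (PPRSparsifier.pprMatrix G α) ∧
        ‖PPRSparsifier.pprMatrix G α - PPRSparsifier.truncatedPPR G α T‖ ≤
            √(Fintype.card V) * (1 - α) ^ (T + 1) ∧
        ENNReal.ofReal (1 - 1 / Fintype.card V) ≤
          (PPRSparsifier.sparsePPR G hα hT N).toOuterMeasure
            {Q : Matrix V V ℝ |
              ‖PPRSparsifier.truncatedPPR G α T - Q‖ ≤
                √(Fintype.card V) * (4 * ε * PPRSparsifier.alphaSum α T) ∧
              ‖PPRSparsifier.pprMatrix G α - Q‖ ≤
                √(Fintype.card V) *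
                  ((1 - α) ^ (T + 1) + 4 * ε * PPRSparsifier.alphaSum α T)} := by
  refine ⟨2, two_pos, fun V _ _ G _ _ hG α hα T hT ε hε hε2 N hN => ?_⟩
  have htrunc := PPRSparsifier.norm_pprMatrix_sub_truncatedPPR_le hG hα T
  refine ⟨PPRSparsifier.hasSum_pprMatrix hG hα, htrunc, ?_⟩
  have hm := PPRSparsifier.card_edgeFinset_pos G
  have hn : (2 : ℝ) ≤ Fintype.card V := by
    have e : G.Dart := Classical.arbitrary _
    exact_mod_cast Fintype.one_lt_card_iff.2 ⟨e.fst, e.snd, e.adj.ne⟩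
  have hn0 : (0 : ℝ) < Fintype.card V := by linarith
  have hlog : 0 < Real.log (Fintype.card V) := Real.log_pos (by linarith)
  have hT1 : (1 : ℝ) ≤ T := by exact_mod_cast hT
  have hNε : 2 * Real.log (Fintype.card V) ≤ N * ε ^ 2 / G.edgeFinset.card := by
    rw [le_div_iff₀ hm]
    rw [div_le_iff₀ (by positivity)] at hN
    refine le_trans ?_ hN
    nlinarith [mul_nonneg (mul_nonneg hlog.le hm.le) (sub_nonneg.2 hT1)]
  -- For `N = 0` the sample weight `m / N` would be junk; `log n > 0` excludes that case.
  have hN0 : N ≠ 0 := by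
    rintro rfl
    simp only [Nat.cast_zero, zero_mul, zero_div] at hNε
    linarith
  have hNpos : (0 : ℝ) < N := by exact_mod_cast Nat.pos_of_ne_zero hN0
  have hsqrt : 1 ≤ √(Fintype.card V : ℝ) := Real.one_le_sqrt.2 (by linarith)
  have hfail := PPRSparsifier.toOuterMeasure_sampledGraph_le hα hT hG hN0
    (l := ε / (2 * G.edgeFinset.card * √(Fintype.card V))) (by positivity)
    (by
      -- The claim reduces to `2 ε ≤ √n`, which is where `ε ≤ 1 / 2` enters.
      rw [div_mul_eq_mul_div, div_le_one (by positivity)]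
      nlinarith [mul_nonneg hm.le (sub_nonneg.2 hsqrt), mul_nonneg hm.le (sub_nonneg.2 hε2)])
    (4 * ε * √(Fintype.card V))
  replace hfail := hfail.trans
    (ENNReal.ofReal_le_ofReal (PPRSparsifier.two_mul_exp_le_inv hn hm hε hNε))
  -- The sampled graphs on which `‖D⁻¹ L̃ - 𝔼 X‖ ≥ 4 ε √n`.
  set bad := {W : Matrix V V ℝ | N * (4 * ε * √(Fintype.card V)) ≤
    N * ‖(G.degMatrix ℝ)⁻¹ * PPRSparsifier.weightedLaplacian W -
      (1 - PPRSparsifier.mixedTransition G α T)‖} with hbad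
  rw [PPRSparsifier.sparsePPR, PMF.toOuterMeasure_map_apply]
  have hcompl := PPRSparsifier.toOuterMeasure_add_compl
    (PPRSparsifier.sampledGraph G hα hT N N) bad
  -- Outside `bad` both error bounds hold.
  calc ENNReal.ofReal (1 - 1 / Fintype.card V)
      = 1 - ENNReal.ofReal (1 / Fintype.card V) := by
        rw [ENNReal.ofReal_sub _ (by positivity), ENNReal.ofReal_one]
    _ ≤ (PPRSparsifier.sampledGraph G hα hT N N).toOuterMeasure badᶜ := by
        rw [tsub_le_iff_left, ← hcompl]
        gcongr
    _ ≤ _ := MeasureTheory.measure_mono ?_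
  intro W hW
  replace hW : ¬ (N * (4 * ε * √(Fintype.card V)) ≤
    N * ‖(G.degMatrix ℝ)⁻¹ * PPRSparsifier.weightedLaplacian W -
      (1 - PPRSparsifier.mixedTransition G α T)‖) := hW
  have hW' : ‖(G.degMatrix ℝ)⁻¹ * PPRSparsifier.weightedLaplacian W -
      (1 - PPRSparsifier.mixedTransition G α T)‖ ≤ 4 * ε * √(Fintype.card V) :=
    (lt_of_mul_lt_mul_left (not_le.1 hW) hNpos.le).le
  have hs := PPRSparsifier.alphaSum_pos hα hT
  set Q := α • (1 : Matrix V V ℝ) + PPRSparsifier.alphaSum α T •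
    ((1 : Matrix V V ℝ) - (G.degMatrix ℝ)⁻¹ * PPRSparsifier.weightedLaplacian W) with hQ
  have hQ1 : ‖PPRSparsifier.truncatedPPR G α T - Q‖ ≤
      √(Fintype.card V) * (4 * ε * PPRSparsifier.alphaSum α T) := by
    have h : PPRSparsifier.truncatedPPR G α T - Q = PPRSparsifier.alphaSum α T •
        ((G.degMatrix ℝ)⁻¹ * PPRSparsifier.weightedLaplacian W -
          (1 - PPRSparsifier.mixedTransition G α T)) := by
      rw [PPRSparsifier.truncatedPPR_eq hα hT, hQ]
      module
    rw [h, norm_smul, Real.norm_of_nonneg hs.le]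
    calc _ ≤ PPRSparsifier.alphaSum α T * (4 * ε * √(Fintype.card V)) := by gcongr
      _ = _ := by ring
  refine ⟨hQ1, ?_⟩
  calc _ ≤ ‖PPRSparsifier.pprMatrix G α - PPRSparsifier.truncatedPPR G α T‖ +
        ‖PPRSparsifier.truncatedPPR G α T - Q‖ := norm_sub_le_norm_sub_add_norm_sub _ _ _
    _ ≤ _ := add_le_add htrunc hQ1
    _ = _ := by ring
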